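/- Let $T$ be an irreducible $n\times n$ matrix with entries in $\{0,1\}$ whose largest eigenvalue $\lambda$ satisfies $\lambda>1$, and let $\Sigma$ be the associated subshift of finite type, i.e. the set of all bi-infinite strings $(x_j)_{j\in\mathbb Z}$ over an alphabet of $n$ symbols such that the $(x_{j+1},x_j)$ entry of $T$ is $1$ for all $j\in\mathbb Z$. For a finite set $S$ of finite words, let $\Sigma\langle S\rangle$ be the set of elements of $\Sigma$ in which no word of $S$ occurs, and let $h$ denote topological entropy of the shift map (natural logarithm). Let $S_1,S_2,\dots$ be finite nonempty sets of nonempty words admissible for $T$ such that, within each $S_i$, no word contains another. Let $\ell_i$ be the minimal length of a word in $S_i$, and suppose that $\ell_i\to\infty$. Suppose that there is a real number $0\le\kappa<\lambda$ such that $|S_i|=O(\kappa^{\ell_i})$ as $i\to\infty$. Then $$\lim_{i\to\infty}h(\Sigma\langle S_i\rangle)=h(\Sigma).$$ Moreover, for every $\alpha\in(0,1/2)$ with $\kappa<\lambda^{1-2\alpha}$, $$h(\Sigma)-h(\Sigma\langle S_i\rangle)=O\left(\left(\frac{\kappa}{\lambda^{1-2\alpha}}\right)^{\alpha\ell_i}\ell_i^{\,\alpha-1}\right)\quad\text{as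 } i\to\infty .$$ -/

import Mathlib

namespace ForbiddenWords

/-- The vertex shift of a 0-1 matrix `T`: all bi-infinite strings `x` such that the
`(x (i + 1), x i)` entry of `T` is `1` for every `i`. -/
def vertexShift {n : ℕ} (T : Matrix (Fin n) (Fin n) ℝ) : Set (ℤ → Fin n) :=
  {x | ∀ i : ℤ, T (x (i + 1)) (x i) = 1}

/-- A finite word is admissible if all its transitions are allowed by `T`. -/
def Admissible {n : ℕ} (T : Matrix (Fin n) (Fin n) ℝ) (w : List (Fin n)) : Prop :=
  w.IsChain (fun a b => T b a = 1)

/-- The finite word `w` occurs in the bi-infinite string `x`, starting at some coordinate `i`. -/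
def Occurs {n : ℕ} (w : List (Fin n)) (x : ℤ → Fin n) : Prop :=
  ∃ i : ℤ, ∀ (j : ℕ) (hj : j < w.length), x (i + j) = w[j]

/-- The strings of the vertex shift of `T` in which no word of `S` occurs. -/
def avoiding {n : ℕ} (T : Matrix (Fin n) (Fin n) ℝ) (S : Finset (List (Fin n))) :
    Set (ℤ → Fin n) :=
  {x | x ∈ vertexShift T ∧ ∀ w ∈ S, ¬ Occurs w x}

/-- The sets of words that may be forbidden: finite sets of nonempty admissible words, none of
which contains another as a block of consecutive letters. -/
structure IsForbiddenSet {n : ℕ} (T : Matrix (Fin n) (Fin n) ℝ) (S : Finset (List (Fin n))) :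
    Prop where
  nonempty_of_mem : ∀ w ∈ S, w ≠ []
  admissible : ∀ w ∈ S, Admissible T w
  eq_of_isInfix : ∀ v ∈ S, ∀ w ∈ S, v <:+: w → v = w

/-- The shift map on bi-infinite strings. -/
def shift {n : ℕ} (x : ℤ → Fin n) : ℤ → Fin n := fun i => x (i + 1)

/-- Topological entropy of the shift map on a set `X` of bi-infinite strings, for the product of
the discrete uniformities on the alphabet (natural logarithm; the empty set has entropy `⊥`). -/
noncomputable def entropy {n : ℕ} (X : Set (ℤ → Fin n)) : EReal :=
  letI : UniformSpace (Fin n) := ⊥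
  Dynamics.coverEntropy shift X

end ForbiddenWords

/-!
The proof counts words, weighted by a Perron eigenvector. Let `T v = lam v` with `v > 0`, which
exists by the Collatz–Wielandt variational principle (`exists_pos_eigenvector`). Let `Z m` be the
sum, over the admissible words of length `m` without a block in `S`, of the entry of `v` at the
first letter. Extending a word by one letter to the left multiplies its weight by `lam`, and an
extension that is no longer allowed starts with some `w ∈ S` and continues with an allowed word;
hence

  `lam * Z m ≤ Z (m + 1) + C * ∑ w ∈ S, Z (m + 1 - |w|)`.

By induction, `Z (m + 1) ≥ β * Z m` as soon as `β ≥ 1` and `C * |S| / β ^ (l - 1) ≤ lam - β`, where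
`l` is the minimal length in `S` (`mul_weightSum_le`).

The words counted by `Z` need not extend to bi-infinite strings that avoid `S`. By compactness,
however, their middle parts do once the margins are long enough (`exists_margin`), and cutting long
words into blocks shows that the words that do extend grow at least as fast
(`pow_le_card_language`). So `h(Σ⟨S⟩) ≥ log β`, while `h(Σ) ≤ log lam` by the same weighted count
without forbidden words.

For `κ < b < lam` one may take `lam - β` to be a multiple of `(κ / b) ^ l`, so that the entropy loss
is `O((κ / b) ^ l)` (`exists_entropy_avoiding_ge`). With `b` close to `lam` this is better than the
claimed rate, because `κ / lam < (κ / lam ^ (1 - 2 * α)) ^ α` (`div_lt_rpow`), and the room between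
the two geometric rates absorbs the power `l ^ (α - 1)`.
-/

namespace ForbiddenWords

/-! ### The Perron eigenvector -/

section Perron

variable {ι : Type*} [Fintype ι]

/-- Some polynomial in an irreducible matrix has only positive entries. -/
lemma exists_commute_pos [DecidableEq ι] {T : Matrix ι ι ℝ} (hT : T.IsIrreducible) :
    ∃ P : Matrix ι ι ℝ, Commute P T ∧ ∀ i j, 0 < P i j := by
  have h := (Matrix.isIrreducible_iff_exists_pow_pos hT.nonneg).1 hT
  choose k hk0 hk using h
  refine ⟨∑ p : ι × ι, T ^ k p.1 p.2, ?_, fun i j => ?_⟩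
  · exact Commute.sum_left _ _ _ fun p _ => (Commute.refl T).pow_left _
  · rw [Matrix.sum_apply]
    exact Finset.sum_pos' (fun p _ => Matrix.pow_apply_nonneg hT.nonneg _ i j)
      ⟨(i, j), Finset.mem_univ _, hk i j⟩

lemma mulVec_pos {P : Matrix ι ι ℝ} (hP : ∀ i j, 0 < P i j) {x : ι → ℝ} (hx : ∀ i, 0 ≤ x i)
    (hx0 : x ≠ 0) (i : ι) : 0 < P.mulVec x i := by
  obtain ⟨j, hj⟩ := Function.ne_iff.1 hx0
  refine Finset.sum_pos' (fun k _ => mul_nonneg (hP i k).le (hx k)) ⟨j, Finset.mem_univ _, ?_⟩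
  exact mul_pos (hP i j) (lt_of_le_of_ne (hx j) (Ne.symm hj))

/-- The pairs `(x, t)` of a probability vector `x` and a number `t ≥ 0` with `t x ≤ T x`
(entrywise); maximizing `t` is the Collatz–Wielandt variational problem. -/
def collatzWielandt (T : Matrix ι ι ℝ) : Set ((ι → ℝ) × ℝ) :=
  {p | p.1 ∈ stdSimplex ℝ ι ∧ 0 ≤ p.2 ∧ ∀ i, p.2 * p.1 i ≤ T.mulVec p.1 i}

lemma isCompact_collatzWielandt {T : Matrix ι ι ℝ} (hT : ∀ i j, 0 ≤ T i j) :
    IsCompact (collatzWielandt T) := by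
  have hsub : collatzWielandt T ⊆ stdSimplex ℝ ι ×ˢ Set.Icc (0 : ℝ) (∑ i, ∑ j, T i j) := by
    rintro ⟨x, t⟩ ⟨hx, ht, h⟩
    refine ⟨hx, ht, ?_⟩
    have h1 : ∑ i, t * x i = t := by
      rw [← Finset.mul_sum, hx.2, mul_one]
    calc t = ∑ i, t * x i := h1.symm
      _ ≤ ∑ i, T.mulVec x i := Finset.sum_le_sum fun i _ => h i
      _ ≤ ∑ i, ∑ j, T i j := by
        refine Finset.sum_le_sum fun i _ => Finset.sum_le_sum fun j _ => ?_
        exact mul_le_of_le_one_right (hT i j)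
          (hx.2 ▸ Finset.single_le_sum (fun k _ => hx.1 k) (Finset.mem_univ j))
  refine ((isCompact_stdSimplex ℝ ι).prod isCompact_Icc).of_isClosed_subset ?_ hsub
  have h1 : IsClosed {p : (ι → ℝ) × ℝ | p.1 ∈ stdSimplex ℝ ι} :=
    (isClosed_stdSimplex ℝ ι).preimage continuous_fst
  have h2 : IsClosed {p : (ι → ℝ) × ℝ | 0 ≤ p.2} := isClosed_le continuous_const continuous_snd
  have h3 : IsClosed {p : (ι → ℝ) × ℝ | ∀ i, p.2 * p.1 i ≤ T.mulVec p.1 i} := by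
    simp only [Set.ofPred_forall]
    refine isClosed_iInter fun i => isClosed_le (by fun_prop) ?_
    exact (continuous_apply i).comp (Continuous.matrix_mulVec continuous_const continuous_fst)
  exact h1.inter (h2.inter h3)

lemma mem_collatzWielandt_of_nonneg {T : Matrix ι ι ℝ} {x : ι → ℝ} {t : ℝ}
    (hx : ∀ i, 0 ≤ x i) (hx0 : x ≠ 0) (ht : 0 ≤ t) (h : ∀ i, t * x i ≤ T.mulVec x i) :
    ((∑ i, x i)⁻¹ • x, t) ∈ collatzWielandt T := by
  obtain ⟨j, hj⟩ := Function.ne_iff.1 hx0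
  have hs : 0 < ∑ i, x i := Finset.sum_pos' (fun i _ => hx i)
    ⟨j, Finset.mem_univ _, lt_of_le_of_ne (hx j) (Ne.symm hj)⟩
  refine ⟨⟨fun i => mul_nonneg (inv_nonneg.2 hs.le) (hx i), ?_⟩, ht, fun i => ?_⟩
  · simp only [Pi.smul_apply, smul_eq_mul, ← Finset.mul_sum]
    exact inv_mul_cancel₀ hs.ne'
  · simp only [Matrix.mulVec_smul, Pi.smul_apply, smul_eq_mul]
    rw [mul_left_comm]
    exact mul_le_mul_of_nonneg_left (h i) (inv_nonneg.2 hs.le)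

/-- The greatest real eigenvalue of an irreducible matrix, if nonnegative, has a positive
eigenvector. -/
theorem exists_pos_eigenvector [DecidableEq ι] {T : Matrix ι ι ℝ} (hT : T.IsIrreducible) {lam : ℝ}
    (hlam : IsGreatest {x : ℝ | Module.End.HasEigenvalue (Matrix.toLin' T) x} lam)
    (h0 : 0 ≤ lam) : ∃ v : ι → ℝ, (∀ i, 0 < v i) ∧ T.mulVec v = lam • v := by
  obtain ⟨P, hPT, hP⟩ := exists_commute_pos hT
  obtain ⟨y, hy⟩ := hlam.1.exists_hasEigenvector
  have hy0 : y ≠ 0 := hy.2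
  have hTy : T.mulVec y = lam • y := by simpa using hy.apply_eq_smul
  -- The absolute value of an eigenvector of `lam` is feasible with value `lam`.
  have hmem : ((∑ i, |y| i)⁻¹ • |y|, lam) ∈ collatzWielandt T := by
    refine mem_collatzWielandt_of_nonneg (fun i => abs_nonneg _) (by simpa using hy0) h0
      fun i => ?_
    calc lam * |y| i = |lam * y i| := by rw [abs_mul, abs_of_nonneg h0, Pi.abs_apply]
      _ = |T.mulVec y i| := by rw [hTy]; rfl
      _ ≤ ∑ j, |T i j * y j| := Finset.abs_sum_le_sum_abs _ _
      _ = T.mulVec |y| i := by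
        refine Finset.sum_congr rfl fun j _ => ?_
        rw [abs_mul, abs_of_nonneg (hT.nonneg i j), Pi.abs_apply]
  obtain ⟨⟨x, r⟩, ⟨hx, hr, hxr⟩, hmax⟩ :=
    (isCompact_collatzWielandt hT.nonneg).exists_isMaxOn ⟨_, hmem⟩ continuous_snd.continuousOn
  have hlr : lam ≤ r := hmax hmem
  simp only at hx hr hxr
  have hx0 : x ≠ 0 := by
    rintro rfl
    simpa using hx.2
  have hz : ∀ i, 0 < P.mulVec x i := mulVec_pos hP hx.1 hx0
  have hcomm : ∀ u, T.mulVec (P.mulVec u) = P.mulVec (T.mulVec u) := fun u => by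
    rw [Matrix.mulVec_mulVec, Matrix.mulVec_mulVec, hPT.eq]
  have : Nonempty ι := ⟨(Function.ne_iff.1 hx0).choose⟩
  have hz0 : P.mulVec x ≠ 0 := fun h => (hz (Classical.arbitrary ι)).ne' (congrFun h _)
  -- A maximizer is an eigenvector: otherwise applying `P` makes all inequalities strict.
  have hTx : T.mulVec x = r • x := by
    by_contra hne
    have hw : ∀ i, 0 < P.mulVec (T.mulVec x - r • x) i :=
      mulVec_pos hP (fun i => sub_nonneg.2 (hxr i)) (sub_ne_zero.2 hne)
    have hlt : ∀ i, r * P.mulVec x i < T.mulVec (P.mulVec x) i := fun i => by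
      have := hw i
      rw [Matrix.mulVec_sub, Matrix.mulVec_smul, ← hcomm] at this
      exact sub_pos.1 this
    obtain ⟨i₀, hi₀⟩ := Finite.exists_min fun i => T.mulVec (P.mulVec x) i / P.mulVec x i
    have hrt : r < T.mulVec (P.mulVec x) i₀ / P.mulVec x i₀ := by
      rw [lt_div_iff₀ (hz i₀)]
      exact hlt i₀
    have h2 := mem_collatzWielandt_of_nonneg (fun i => (hz i).le) hz0 (hr.trans hrt.le)
      fun i => (le_div_iff₀ (hz i)).1 (hi₀ i)
    exact absurd (hmax h2) (not_le.2 hrt)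
  have hTz : T.mulVec (P.mulVec x) = r • P.mulVec x := by
    rw [hcomm, hTx, Matrix.mulVec_smul]
  have hrl : r ≤ lam := hlam.2 <| Module.End.hasEigenvalue_of_hasEigenvector
    (x := P.mulVec x) ⟨Module.End.mem_eigenspace_iff.2 (by simpa using hTz), hz0⟩
  exact ⟨_, hz, le_antisymm hrl hlr ▸ hTz⟩

end Perron

/-! ### Counting the words that avoid `S` -/

section Counting

lemma sum_biUnion_le {α ι : Type*} [DecidableEq α] {f : α → ℝ} (hf : ∀ x, 0 ≤ f x)
    (s : Finset ι) (t : ι → Finset α) :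
    ∑ x ∈ s.biUnion t, f x ≤ ∑ i ∈ s, ∑ x ∈ t i, f x := by
  classical
  induction s using Finset.induction_on with
  | empty => simp
  | insert i s hi ih =>
    rw [Finset.biUnion_insert, Finset.sum_insert hi]
    have h := Finset.sum_union_inter (s₁ := t i) (s₂ := s.biUnion t) (f := f)
    have h' : 0 ≤ ∑ x ∈ t i ∩ s.biUnion t, f x := Finset.sum_nonneg fun x _ => hf x
    linarith

variable {n : ℕ} {T : Matrix (Fin n) (Fin n) ℝ} {S : Finset (List (Fin n))}

/-- An admissible finite word none of whose blocks belongs to `S`. It need not occur in any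
bi-infinite string of `avoiding T S`. -/
def Good (T : Matrix (Fin n) (Fin n) ℝ) (S : Finset (List (Fin n))) (u : List (Fin n)) : Prop :=
  Admissible T u ∧ ∀ w ∈ S, ¬ w <:+: u

lemma Good.of_isInfix {u u' : List (Fin n)} (h : Good T S u) (hu : u' <:+: u) : Good T S u' :=
  ⟨h.1.infix hu, fun w hw hw' => h.2 w hw (hw'.trans hu)⟩

open Classical in
/-- The finite set of good words of length `m`. -/
noncomputable def words (T : Matrix (Fin n) (Fin n) ℝ) (S : Finset (List (Fin n))) (m : ℕ) :
    Finset (List (Fin n)) :=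
  (List.finite_length_eq (Fin n) m).toFinset.filter (Good T S)

@[simp]
lemma mem_words {m : ℕ} {u : List (Fin n)} : u ∈ words T S m ↔ u.length = m ∧ Good T S u := by
  simp [words]

/-- The weight of a word: the entry of `v` at its first letter, and `c` for the empty word. -/
def weight (v : Fin n → ℝ) (c : ℝ) : List (Fin n) → ℝ
  | [] => c
  | a :: _ => v a

/-- The total weight of the good words of length `m`. -/
noncomputable def weightSum (T : Matrix (Fin n) (Fin n) ℝ) (S : Finset (List (Fin n)))
    (v : Fin n → ℝ) (c : ℝ) (m : ℕ) : ℝ :=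
  ∑ u ∈ words T S m, weight v c u

variable {v : Fin n → ℝ} {c lam : ℝ}

lemma weight_nonneg (hv : ∀ i, 0 ≤ v i) (hc : 0 ≤ c) (u : List (Fin n)) : 0 ≤ weight v c u := by
  cases u
  exacts [hc, hv _]

lemma weightSum_nonneg (hv : ∀ i, 0 ≤ v i) (hc : 0 ≤ c) (m : ℕ) : 0 ≤ weightSum T S v c m :=
  Finset.sum_nonneg fun _ _ => weight_nonneg hv hc _

open Classical in
/-- Since `v` is an eigenvector, the admissible extensions of a word by one letter to the left
weigh `lam` times as much as the word. -/
lemma sum_weight_cons (hT : ∀ i j, T i j = 0 ∨ T i j = 1) (hTv : T.mulVec v = lam • v)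
    (hc : lam * c = ∑ i, v i) {u : List (Fin n)} (hu : Admissible T u) :
    ∑ b with Admissible T (b :: u), v b = lam * weight v c u := by
  cases u with
  | nil => simp [weight, hc, Admissible]
  | cons a u =>
    have h := congrFun hTv a
    simp only [Pi.smul_apply, smul_eq_mul] at h
    rw [weight, ← h, Finset.sum_filter]
    refine Finset.sum_congr rfl fun b _ => ?_
    have hb : Admissible T (b :: a :: u) ↔ T a b = 1 := by
      simp only [Admissible, List.isChain_cons_cons]
      exact and_iff_left hu
    rcases hT a b with h | h <;> simp [hb, h]

/-- The one-letter extensions of good words are good or start with a word of `S`, and in the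
latter case the rest is again good. -/
lemma lam_mul_weightSum_le (hT : ∀ i j, T i j = 0 ∨ T i j = 1) (hTv : T.mulVec v = lam • v)
    (hv : ∀ i, 0 ≤ v i) (hc0 : 0 ≤ c) (hc : lam * c = ∑ i, v i)
    {C : ℝ} (hC : ∀ b u, v b ≤ C * weight v c u) (hS : ∀ w ∈ S, w ≠ []) (m : ℕ) :
    lam * weightSum T S v c m ≤ weightSum T S v c (m + 1) +
      ∑ w ∈ S with w.length ≤ m + 1, C * weightSum T S v c (m + 1 - w.length) := by
  classical
  set E : Finset (List (Fin n)) :=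
    (words T S m).biUnion fun u =>
      ({b | Admissible T (b :: u)} : Finset (Fin n)).image (· :: u) with hE
  have hEsum : lam * weightSum T S v c m = ∑ y ∈ E, weight v c y := by
    rw [hE, Finset.sum_biUnion, weightSum, Finset.mul_sum]
    · refine Finset.sum_congr rfl fun u hu => ?_
      rw [Finset.sum_image (by simp), ← sum_weight_cons hT hTv hc (mem_words.1 hu).2.1]
      rfl
    · intro u _ u' _ huu'
      simp only [Function.onFun, Finset.disjoint_left, Finset.mem_image]
      rintro _ ⟨b, _, rfl⟩ ⟨b', _, h⟩
      exact huu' (List.cons.inj h).2.symm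
  have hsub : E \ words T S (m + 1) ⊆ (S.filter fun w => w.length ≤ m + 1).biUnion fun w =>
      (words T S (m + 1 - w.length)).image (w ++ ·) := by
    intro y hy
    simp only [hE, Finset.mem_sdiff, Finset.mem_biUnion, Finset.mem_image, Finset.mem_filter,
      Finset.mem_univ, true_and, mem_words] at hy ⊢
    obtain ⟨⟨u, ⟨hum, hug⟩, b, hb, rfl⟩, hnot⟩ := hy
    have hbad : ∃ w ∈ S, w <:+: b :: u := by
      by_contra! hcon
      exact hnot ⟨by simp [hum], hb, hcon⟩
    obtain ⟨w, hw, hwu⟩ := hbad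
    rcases List.infix_cons_iff.1 hwu with ⟨p, hp⟩ | h
    · have hlen := congrArg List.length hp
      simp only [List.length_append, List.length_cons, hum] at hlen
      refine ⟨w, ⟨hw, by omega⟩, p, ⟨by omega, hug.of_isInfix ?_⟩, hp⟩
      cases w with
      | nil => exact absurd rfl (hS _ hw)
      | cons a w =>
        simp only [List.cons_append, List.cons.injEq] at hp
        exact ⟨w, [], by simp [hp.2]⟩
    · exact absurd h (hug.2 w hw)
  have hw0 := weight_nonneg (v := v) (c := c) hv hc0
  rw [hEsum, ← Finset.sum_inter_add_sum_sdiff E (words T S (m + 1))]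
  refine add_le_add (Finset.sum_le_sum_of_subset_of_nonneg Finset.inter_subset_right
    fun _ _ _ => hw0 _) ?_
  refine (Finset.sum_le_sum_of_subset_of_nonneg hsub fun _ _ _ => hw0 _).trans ?_
  refine (sum_biUnion_le (weight_nonneg hv hc0) _ _).trans (Finset.sum_le_sum fun w hw => ?_)
  rw [Finset.sum_image (by simp), weightSum, Finset.mul_sum]
  refine Finset.sum_le_sum fun p _ => ?_
  cases w with
  | nil => exact absurd rfl (hS _ (Finset.mem_filter.1 hw).1)
  | cons a w => exact hC a p

/-- If the words of `S` have length at least `l` and are few, the weight of the good words grows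
at least by a factor `β` per letter. -/
lemma mul_weightSum_le (hT : ∀ i j, T i j = 0 ∨ T i j = 1) (hTv : T.mulVec v = lam • v)
    (hv : ∀ i, 0 ≤ v i) (hc0 : 0 ≤ c) (hc : lam * c = ∑ i, v i)
    {C : ℝ} (hC0 : 0 ≤ C) (hC : ∀ b u, v b ≤ C * weight v c u)
    {l : ℕ} (hl0 : 1 ≤ l) (hl : ∀ w ∈ S, l ≤ w.length) {β : ℝ} (hβ : 1 ≤ β)
    (hβS : C * S.card / β ^ (l - 1) ≤ lam - β) (m : ℕ) :
    β * weightSum T S v c m ≤ weightSum T S v c (m + 1) := by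
  induction m using Nat.strong_induction_on with
  | _ m ih =>
  have hβ0 : 0 < β := one_pos.trans_le hβ
  have hZ := weightSum_nonneg (T := T) (S := S) hv hc0
  have hpow : ∀ k ≤ m, β ^ k * weightSum T S v c (m - k) ≤ weightSum T S v c m := by
    intro k
    induction k with
    | zero => simp
    | succ k ihk =>
      intro hk
      refine le_trans ?_ (ihk (by omega))
      have h := ih (m - (k + 1)) (by omega)
      rw [show m - (k + 1) + 1 = m - k by omega] at h
      rw [pow_succ, mul_assoc]
      exact mul_le_mul_of_nonneg_left h (by positivity)
  have hS : ∀ w ∈ S, w ≠ [] := by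
    rintro w hw rfl
    have := hl _ hw
    simp at this
    omega
  have hmain := lam_mul_weightSum_le hT hTv hv hc0 hc hC hS m
  have hterm : ∀ w ∈ S.filter fun w => w.length ≤ m + 1,
      C * weightSum T S v c (m + 1 - w.length) ≤ C * weightSum T S v c m / β ^ (l - 1) := by
    intro w hw
    obtain ⟨hwS, hwm⟩ := Finset.mem_filter.1 hw
    have hlw := hl w hwS
    rw [mul_div_assoc]
    refine mul_le_mul_of_nonneg_left ?_ hC0
    rw [le_div_iff₀ (by positivity), mul_comm]
    have h := hpow (w.length - 1) (by omega)
    rw [show m - (w.length - 1) = m + 1 - w.length by omega] at h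
    exact (mul_le_mul_of_nonneg_right (pow_le_pow_right₀ hβ (by omega)) (hZ _)).trans h
  have hsum := Finset.sum_le_card_nsmul _ _ _ hterm
  rw [nsmul_eq_mul] at hsum
  have hcard : (((S.filter fun w => w.length ≤ m + 1).card : ℕ) : ℝ) ≤ S.card := by
    exact_mod_cast Finset.card_filter_le _ _
  have h1 : (((S.filter fun w => w.length ≤ m + 1).card : ℕ) : ℝ) *
      (C * weightSum T S v c m / β ^ (l - 1)) ≤ (lam - β) * weightSum T S v c m := by
    calc _ ≤ (S.card : ℝ) * (C * weightSum T S v c m / β ^ (l - 1)) :=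
          mul_le_mul_of_nonneg_right hcard
            (div_nonneg (mul_nonneg hC0 (hZ _)) (by positivity))
      _ = C * S.card / β ^ (l - 1) * weightSum T S v c m := by ring
      _ ≤ _ := mul_le_mul_of_nonneg_right hβS (hZ _)
  linarith

/-- Constants comparing weights with cardinalities, for a positive eigenvector. -/
lemma exists_weight_bounds [NeZero n] (hv : ∀ i, 0 < v i) (hlam : 0 < lam) :
    ∃ c a C : ℝ, 0 < c ∧ 0 < a ∧ 0 < C ∧ lam * c = ∑ i, v i ∧
      (∀ b u, v b ≤ C * weight v c u) ∧ (∀ u, a ≤ weight v c u) ∧ (∀ u, weight v c u ≤ C) := by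
  have hs : 0 < ∑ i, v i := Finset.sum_pos (fun i _ => hv i) Finset.univ_nonempty
  set c := (∑ i, v i) / lam with hc
  have hc0 : 0 < c := div_pos hs hlam
  obtain ⟨i₀, hi₀⟩ := Finite.exists_min v
  obtain ⟨i₁, hi₁⟩ := Finite.exists_max v
  set a := min c (v i₀)
  have ha : 0 < a := lt_min hc0 (hv _)
  set M := max c (v i₁)
  have hM : 0 < M := lt_max_of_lt_left hc0
  have hau : ∀ u, a ≤ weight v c u := by
    rintro (_ | ⟨b, u⟩)
    exacts [min_le_left _ _, (min_le_right _ _).trans (hi₀ b)]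
  have huM : ∀ u, weight v c u ≤ M := by
    rintro (_ | ⟨b, u⟩)
    exacts [le_max_left _ _, (hi₁ b).trans (le_max_right _ _)]
  refine ⟨c, a, max M (M / a), hc0, ha, lt_max_of_lt_left hM, by rw [hc]; field_simp,
    fun b u => ?_, hau, fun u => (huM u).trans (le_max_left _ _)⟩
  calc v b ≤ M := huM [b]
    _ = M / a * a := by field_simp
    _ ≤ max M (M / a) * weight v c u :=
      mul_le_mul (le_max_right _ _) (hau u) ha.le (hM.le.trans (le_max_left _ _))

/-- Without forbidden words the weight grows exactly by the factor `lam`. -/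
lemma weightSum_empty_succ (hT : ∀ i j, T i j = 0 ∨ T i j = 1) (hTv : T.mulVec v = lam • v)
    (hv : ∀ i, 0 ≤ v i) (hc0 : 0 ≤ c) (hc : lam * c = ∑ i, v i) (m : ℕ) :
    weightSum T ∅ v c (m + 1) ≤ lam * weightSum T ∅ v c m := by
  classical
  have hsub : words T ∅ (m + 1) ⊆ (words T ∅ m).biUnion fun u =>
      ({b | Admissible T (b :: u)} : Finset (Fin n)).image (· :: u) := by
    intro y hy
    obtain ⟨hlen, hg⟩ := mem_words.1 hy
    cases y with
    | nil => simp at hlen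
    | cons b u =>
      simp only [Finset.mem_biUnion, Finset.mem_image, Finset.mem_filter, Finset.mem_univ,
        true_and, mem_words]
      exact ⟨u, ⟨by simpa using hlen, hg.of_isInfix (List.suffix_cons b u).isInfix⟩, b, hg.1, rfl⟩
  refine (Finset.sum_le_sum_of_subset_of_nonneg hsub fun _ _ _ => weight_nonneg hv hc0 _).trans ?_
  refine (sum_biUnion_le (weight_nonneg hv hc0) _ _).trans ?_
  rw [weightSum, Finset.mul_sum]
  refine Finset.sum_le_sum fun u hu => ?_
  rw [Finset.sum_image (by simp), ← sum_weight_cons hT hTv hc (mem_words.1 hu).2.1]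
  rfl

end Counting

/-! ### Words occurring in bi-infinite strings -/

section Language

variable {n : ℕ} {T : Matrix (Fin n) (Fin n) ℝ} {S : Finset (List (Fin n))}

/-- The word of length `k` that occurs in `x` at coordinate `i`. -/
def window (x : ℤ → Fin n) (i : ℤ) (k : ℕ) : List (Fin n) :=
  (List.range k).map fun j : ℕ => x (i + j)

@[simp]
lemma length_window (x : ℤ → Fin n) (i : ℤ) (k : ℕ) : (window x i k).length = k := by
  simp [window]

@[simp]
lemma getElem_window (x : ℤ → Fin n) (i : ℤ) (k j : ℕ) (hj : j < (window x i k).length) :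
    (window x i k)[j] = x (i + j) := by
  simp [window]

lemma window_eq_iff {x : ℤ → Fin n} {i : ℤ} {u : List (Fin n)} :
    window x i u.length = u ↔ ∀ (j : ℕ) (hj : j < u.length), x (i + j) = u[j] := by
  constructor
  · intro h j hj
    have hj' : j < (window x i u.length).length := by simpa using hj
    rw [← getElem_window x i u.length j hj']
    exact List.getElem_of_eq h hj'
  · intro h
    refine List.ext_getElem (by simp) fun j hj hj' => ?_
    rw [getElem_window, h j hj']

lemma window_congr {x y : ℤ → Fin n} {i i' : ℤ} {k : ℕ} :
    window x i k = window y i' k ↔ ∀ j < k, x (i + j) = y (i' + j) := by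
  have h := window_eq_iff (x := x) (i := i) (u := window y i' k)
  simpa only [length_window, getElem_window] using h

lemma occurs_iff {w : List (Fin n)} {x : ℤ → Fin n} :
    Occurs w x ↔ ∃ i, window x i w.length = w := by
  simp only [Occurs, window_eq_iff]

lemma window_add (x : ℤ → Fin n) (i : ℤ) (k l : ℕ) :
    window x i (k + l) = window x i k ++ window x (i + k) l := by
  simp [window, List.range_add, add_assoc]

lemma window_isInfix (x : ℤ → Fin n) {i j : ℤ} {k l : ℕ} (h : i ≤ j) (h' : j + l ≤ i + k) :
    window x j l <:+: window x i k := by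
  obtain ⟨p, rfl⟩ := Int.le.dest h
  obtain ⟨q, rfl⟩ : ∃ q, k = p + l + q := Nat.exists_eq_add_of_le (by omega)
  exact ⟨window x i p, window x (i + (p + l : ℕ)) q, by rw [window_add, window_add]⟩

lemma admissible_window_iff {x : ℤ → Fin n} {i : ℤ} {k : ℕ} :
    Admissible T (window x i k) ↔ ∀ j : ℕ, j + 1 < k → T (x (i + j + 1)) (x (i + j)) = 1 := by
  simp only [Admissible, List.isChain_iff_getElem, length_window, getElem_window]
  simp only [Nat.cast_add, Nat.cast_one, ← add_assoc]

lemma good_window {x : ℤ → Fin n} (hx : x ∈ avoiding T S) (i : ℤ) (k : ℕ) :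
    Good T S (window x i k) := by
  refine ⟨admissible_window_iff.2 fun j _ => hx.1 _, ?_⟩
  rintro w hw ⟨a, b, hab⟩
  refine hx.2 w hw (occurs_iff.2 ⟨i + a.length, ?_⟩)
  have hk : k = a.length + w.length + b.length := by
    simpa [add_assoc] using (congrArg List.length hab).symm
  rw [hk, window_add, window_add] at hab
  have h1 := (List.append_inj hab (by simp)).1
  exact (List.append_inj h1 (by simp)).2.symm

lemma mem_avoiding_of_good_window {x : ℤ → Fin n} {m : ℕ}
    (hx : ∀ M : ℕ, Good T S (window x (-M) (M + m + M))) : x ∈ avoiding T S := by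
  refine ⟨fun i => ?_, fun w hw hocc => ?_⟩
  · have h := (hx (i.natAbs + 2)).of_isInfix
      (window_isInfix x (j := i) (l := 2) (by omega) (by omega))
    simpa using admissible_window_iff.1 h.1 0 (by norm_num)
  · obtain ⟨i, hi⟩ := occurs_iff.1 hocc
    refine (hx (i.natAbs + w.length)).2 w hw ?_
    nth_rewrite 1 [← hi]
    exact window_isInfix x (by omega) (by omega)

lemma translate_mem_avoiding {x : ℤ → Fin n} (hx : x ∈ avoiding T S) (k : ℤ) :
    (fun i => x (k + i)) ∈ avoiding T S := by
  refine ⟨fun i => ?_, fun w hw => ?_⟩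
  · simpa only [add_assoc] using hx.1 (k + i)
  · rintro ⟨i, hi⟩
    exact hx.2 w hw ⟨k + i, fun j hj => by rw [← hi j hj, add_assoc]⟩

/-- A bi-infinite string that reads `u` from coordinate `-M` on, padded with the letter `0`. -/
def fill [NeZero n] (u : List (Fin n)) (M : ℕ) : ℤ → Fin n :=
  fun i => u.getD (i + M).toNat 0

lemma window_fill [NeZero n] (u : List (Fin n)) (M : ℕ) :
    window (fill u M) (-M) u.length = u := by
  rw [window_eq_iff]
  intro j hj
  simp [fill, hj]

/-- The finite set of all words of length `m`. -/
noncomputable def allWords (n m : ℕ) : Finset (List (Fin n)) :=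
  (List.finite_length_eq (Fin n) m).toFinset

@[simp]
lemma mem_allWords {m : ℕ} {u : List (Fin n)} : u ∈ allWords n m ↔ u.length = m := by
  simp [allWords]

open Classical in
/-- The words of length `m` that occur in some string of `avoiding T S`; as this set of strings
is shift invariant, the coordinate `0` is no restriction. -/
noncomputable def language (T : Matrix (Fin n) (Fin n) ℝ) (S : Finset (List (Fin n))) (m : ℕ) :
    Finset (List (Fin n)) :=
  (allWords n m).filter fun u => ∃ x ∈ avoiding T S, window x 0 m = u

lemma mem_language {m : ℕ} {u : List (Fin n)} :
    u ∈ language T S m ↔ ∃ x ∈ avoiding T S, window x 0 m = u := by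
  simp only [language, Finset.mem_filter, mem_allWords, and_iff_right_iff_imp]
  rintro ⟨x, _, rfl⟩
  simp

/-- By compactness, the middle part of a good word with long enough margins occurs in a
bi-infinite string of `avoiding T S`. -/
lemma exists_margin [NeZero n] (T : Matrix (Fin n) (Fin n) ℝ) (S : Finset (List (Fin n)))
    (m : ℕ) : ∃ M : ℕ, ∀ a u b : List (Fin n), a.length = M → u.length = m → b.length = M →
      Good T S (a ++ u ++ b) → u ∈ language T S m := by
  let F : ℕ → Set (ℤ → Fin n) := fun M =>
    {x | Good T S (window x (-M) (M + m + M)) ∧ window x 0 m ∉ language T S m}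
  have hclosed : ∀ (i : ℤ) (k : ℕ) (P : List (Fin n) → Prop),
      IsClosed {x : ℤ → Fin n | P (window x i k)} := by
    intro i k P
    have hc : Continuous fun (x : ℤ → Fin n) (j : Fin k) => x (i + j) := by fun_prop
    have h := (isClosed_discrete {f : Fin k → Fin n | P (List.ofFn f)}).preimage hc
    convert h using 1
    ext x
    simp only [Set.mem_ofPred_eq, Set.mem_preimage]
    rw [show window x i k = List.ofFn fun j : Fin k => x (i + j) from
      List.ext_getElem (by simp) fun j _ _ => by simp]
  have hF : ∀ M, IsClosed (F M) := fun M =>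
    (hclosed _ _ (Good T S)).inter (hclosed _ _ (· ∉ language T S m))
  have hanti : ∀ M, F (M + 1) ⊆ F M := fun M x hx =>
    ⟨hx.1.of_isInfix (window_isInfix x (by omega) (by omega)), hx.2⟩
  by_contra! hcon
  have hne : ∀ M, (F M).Nonempty := by
    intro M
    obtain ⟨a, u, b, ha, hu, hb, hg, hnot⟩ := hcon M
    have hlen : (a ++ u ++ b).length = M + m + M := by simp [ha, hu, hb, add_assoc]
    have hw := window_fill (a ++ u ++ b) M
    rw [hlen] at hw
    refine ⟨fill (a ++ u ++ b) M, show Good T S _ from hw.symm ▸ hg, ?_⟩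
    rw [window_add, window_add] at hw
    have h1 := (List.append_inj hw (by simp [ha, hu])).1
    have h2 := (List.append_inj h1 (by simp [ha])).2
    rw [neg_add_cancel] at h2
    rwa [h2]
  obtain ⟨x, hx⟩ := IsCompact.nonempty_iInter_of_sequence_nonempty_isCompact_isClosed F hanti hne
    (hF 0).isCompact hF
  rw [Set.mem_iInter] at hx
  exact (hx 0).2 (mem_language.2 ⟨x, mem_avoiding_of_good_window fun M => (hx M).1, rfl⟩)

/-- Cutting a good word into blocks: up to a constant factor, there are at most
`(language T S m).card ^ k` good words of length about `m * k`. -/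
lemma exists_card_words_le [NeZero n] (T : Matrix (Fin n) (Fin n) ℝ) (S : Finset (List (Fin n)))
    (m : ℕ) : ∃ M K : ℕ, ∀ k, (words T S (M + m * k + M)).card ≤ K * (language T S m).card ^ k := by
  classical
  obtain ⟨M, hM⟩ := exists_margin T S m
  -- `E k` consists of the middle parts of the words to be counted.
  let E : ℕ → Finset (List (Fin n)) := fun k => (allWords n (m * k)).filter fun y =>
    ∃ a b : List (Fin n), a.length = M ∧ b.length = M ∧ Good T S (a ++ y ++ b)
  have hE0 : (E 0).card ≤ 1 := by
    refine Finset.card_le_one.2 fun x hx y hy => ?_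
    have hx := mem_allWords.1 (Finset.mem_filter.1 hx).1
    have hy := mem_allWords.1 (Finset.mem_filter.1 hy).1
    rw [mul_zero, List.length_eq_zero_iff] at hx hy
    rw [hx, hy]
  have hEs : ∀ k, (E (k + 1)).card ≤ (language T S m).card * (E k).card := by
    intro k
    rw [← Finset.card_product]
    refine Finset.card_le_card_of_injOn (fun y => (y.take m, y.drop m)) ?_ ?_
    · intro y hy
      obtain ⟨hlen, a, b, ha, hb, hg⟩ := Finset.mem_filter.1 hy
      rw [mem_allWords, mul_add, mul_one] at hlen
      have hsplit : a ++ y ++ b = a ++ y.take m ++ (y.drop m ++ b) := by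
        rw [List.append_assoc a (y.take m), ← List.append_assoc (y.take m), List.take_append_drop,
          List.append_assoc]
      refine Finset.mem_product.2 ⟨?_, Finset.mem_filter.2 ⟨?_, ?_⟩⟩
      · refine hM a (y.take m) ((y.drop m ++ b).take M) ha (by simp; omega) (by simp; omega) ?_
        refine hg.of_isInfix ?_
        rw [hsplit]
        exact ((List.prefix_append_right_inj _).2 (List.take_prefix _ _)).isInfix
      · simp only [mem_allWords, List.length_drop]
        omega
      · refine ⟨(a ++ y.take m).drop m, b, by simp; omega, hb, hg.of_isInfix ?_⟩
        rw [hsplit, List.append_assoc]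
        refine ⟨(a ++ y.take m).take m, [], ?_⟩
        simp only [List.append_nil, ← List.append_assoc, List.take_append_drop]
    · intro y _ y' _ h
      simp only [Prod.mk.injEq] at h
      rw [← List.take_append_drop m y, h.1, h.2, List.take_append_drop]
  have hE : ∀ k, (E k).card ≤ (language T S m).card ^ k := by
    intro k
    induction k with
    | zero => simpa using hE0
    | succ k ih =>
      rw [pow_succ']
      exact (hEs k).trans (Nat.mul_le_mul_left _ ih)
  refine ⟨M, (allWords n M).card * (allWords n M).card, fun k => ?_⟩
  refine le_trans ?_ (Nat.mul_le_mul_left _ (hE k))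
  rw [← Finset.card_product, ← Finset.card_product]
  refine Finset.card_le_card_of_injOn
    (fun y => ((y.take M, (y.drop M).drop (m * k)), (y.drop M).take (m * k))) ?_ ?_
  · intro y hy
    obtain ⟨hlen, hg⟩ := mem_words.1 hy
    refine Finset.mem_product.2 ⟨Finset.mem_product.2 ⟨?_, ?_⟩, Finset.mem_filter.2 ⟨?_, ?_⟩⟩
    · simp only [mem_allWords, List.length_take]
      omega
    · simp only [mem_allWords, List.length_drop]
      omega
    · simp only [mem_allWords, List.length_take, List.length_drop]
      omega
    · refine ⟨y.take M, (y.drop M).drop (m * k), ?_, ?_, ?_⟩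
      · simp only [List.length_take]
        omega
      · simp only [List.length_drop]
        omega
      · rw [List.append_assoc, List.take_append_drop, List.take_append_drop]
        exact hg
  · intro y _ y' _ h
    simp only [Prod.mk.injEq] at h
    rw [← List.take_append_drop M y, ← List.take_append_drop (m * k) (y.drop M), h.1.1, h.1.2, h.2,
      List.take_append_drop, List.take_append_drop]

/-- If the number of good words grows at least like `β ^ m`, then so does the number of words that
occur in bi-infinite strings. -/
lemma pow_le_card_language [NeZero n] {β c : ℝ} (hβ : 1 ≤ β) (hc : 0 < c)
    (h : ∀ m, c * β ^ m ≤ (words T S m).card) (m : ℕ) : β ^ m ≤ (language T S m).card := by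
  obtain ⟨M, K, hMK⟩ := exists_card_words_le T S m
  have hβ0 : 0 < β := one_pos.trans_le hβ
  set B : ℝ := ((language T S m).card : ℝ) with hB
  have hbound : ∀ k, c * (β ^ m) ^ k ≤ K * B ^ k := by
    intro k
    calc c * (β ^ m) ^ k = c * β ^ (m * k) := by rw [pow_mul]
      _ ≤ c * β ^ (M + m * k + M) :=
        mul_le_mul_of_nonneg_left (pow_le_pow_right₀ hβ (by omega)) hc.le
      _ ≤ (words T S (M + m * k + M)).card := h _
      _ ≤ K * B ^ k := by rw [hB]; exact_mod_cast hMK k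
  by_contra! hlt
  have hB0 : 0 < B := by
    refine lt_of_le_of_ne (Nat.cast_nonneg _) fun h0 => ?_
    have := hbound 1
    rw [← h0, pow_one, pow_one, mul_zero] at this
    exact absurd this (not_le.2 (by positivity))
  obtain ⟨k, hk⟩ := pow_unbounded_of_one_lt (K / c) ((one_lt_div hB0).2 hlt)
  rw [div_pow, div_lt_div_iff₀ hc (by positivity)] at hk
  linarith [hbound k]

end Language

/-! ### Entropy and word counts -/

section Entropy

variable {n : ℕ} {T : Matrix (Fin n) (Fin n) ℝ} {S : Finset (List (Fin n))}

lemma iterate_shift (k : ℕ) (x : ℤ → Fin n) : shift^[k] x = fun i => x (i + k) := by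
  induction k generalizing x with
  | zero => simp
  | succ k ih =>
    rw [Function.iterate_succ_apply, ih]
    funext i
    simp only [shift, Nat.cast_add, Nat.cast_one, add_assoc]

lemma log_le_entropy {β : ℝ} (hβ : 0 < β) (h : ∀ m, β ^ m ≤ (language T S m).card) :
    (Real.log β : EReal) ≤ entropy (avoiding T S) := by
  classical
  let : UniformSpace (Fin n) := ⊥
  let U : SetRel (ℤ → Fin n) (ℤ → Fin n) := {p | p.1 0 = p.2 0}
  have hU : U ∈ uniformity (ℤ → Fin n) := by
    have h1 : SetRel.id ∈ uniformity (Fin n) := by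
      rw [bot_uniformity]
      exact Filter.mem_principal_self _
    have h2 := Pi.uniformContinuous_proj (fun _ : ℤ => Fin n) 0 h1
    filter_upwards [h2] with p hp using hp
  change _ ≤ Dynamics.coverEntropy shift (avoiding T S)
  refine le_trans ?_ (Dynamics.coverEntropyEntourage_le_coverEntropy _ _ hU)
  rw [← ENNReal.log_ofReal_of_pos hβ, ← ExpGrowth.expGrowthSup_pow]
  refine ExpGrowth.expGrowthSup_monotone fun m => ?_
  have hcount : ((language T S m).card : ℕ∞) ≤
      Dynamics.coverMincard shift (avoiding T S) U m := by
    refine le_iInf₂ fun s hs => ?_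
    have hsub : language T S m ⊆ s.image fun y => window y 0 m := by
      intro u hu
      obtain ⟨x, hx, rfl⟩ := mem_language.1 hu
      obtain ⟨y, hy, hxy⟩ := hs hx
      refine Finset.mem_image.2 ⟨y, hy, window_congr.2 fun j hj => ?_⟩
      have := Dynamics.mem_dynEntourage.1 hxy j hj
      simpa [U, iterate_shift] using this.symm
    exact_mod_cast (Finset.card_le_card hsub).trans Finset.card_image_le
  calc ENNReal.ofReal β ^ m = ENNReal.ofReal (β ^ m) := (ENNReal.ofReal_pow hβ.le m).symm
    _ ≤ ENNReal.ofReal ((language T S m).card : ℝ) := ENNReal.ofReal_le_ofReal (h m)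
    _ = (((language T S m).card : ℕ∞) : ENNReal) := by simp
    _ ≤ _ := ENat.toENNReal_mono hcount

lemma entropy_mono {X Y : Set (ℤ → Fin n)} (h : X ⊆ Y) : entropy X ≤ entropy Y := by
  let : UniformSpace (Fin n) := ⊥
  exact Dynamics.coverEntropy_monotone shift h

lemma avoiding_empty : avoiding T ∅ = vertexShift T := by
  ext x
  simp [avoiding]

lemma entropy_le_log [NeZero n] {lam C : ℝ} (hlam : 0 < lam)
    (h : ∀ m, ((words T S m).card : ℝ) ≤ C * lam ^ m) :
    entropy (avoiding T S) ≤ (Real.log lam : EReal) := by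
  classical
  let : UniformSpace (Fin n) := ⊥
  change Dynamics.coverEntropy shift (avoiding T S) ≤ _
  refine iSup₂_le fun U hU => ?_
  -- `U` only sees finitely many coordinates.
  obtain ⟨M, hM⟩ : ∃ M : ℕ, ∀ x y : ℤ → Fin n, (∀ i : ℤ, -M ≤ i → i ≤ M → x i = y i) →
      (x, y) ∈ U := by
    rw [Pi.uniformity] at hU
    simp only [bot_uniformity, Filter.comap_principal] at hU
    obtain ⟨t, ht, htU⟩ := (Filter.hasBasis_iInf_principal_finite _).mem_iff.1 hU
    obtain ⟨M, hM⟩ := (ht.image Int.natAbs).bddAbove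
    refine ⟨M, fun x y hxy => htU (Set.mem_iInter₂.2 fun i hi => ?_)⟩
    have := hM (Set.mem_image_of_mem _ hi)
    exact hxy i (by omega) (by omega)
  have hcount : ∀ m, Dynamics.coverMincard shift (avoiding T S) U m ≤
      ((words T S (M + m + M)).card : ℕ∞) := by
    intro m
    have hcov : Dynamics.IsDynCoverOf shift (avoiding T S) U m
        ((words T S (M + m + M)).image fun u => fill u M : Finset (ℤ → Fin n)) := by
      intro x hx
      refine ⟨fill (window x (-M) (M + m + M)) M, ?_, ?_⟩
      · simp only [Finset.coe_image]
        exact ⟨_, mem_words.2 ⟨by simp, good_window hx _ _⟩, rfl⟩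
      · refine Dynamics.mem_dynEntourage.2 fun k hk => hM _ _ fun i hi hi' => ?_
        have hw := window_fill (window x (-M) (M + m + M)) M
        rw [length_window, window_congr] at hw
        have h1 := hw (i + k + M).toNat (by omega)
        have h2 : -(M : ℤ) + ((i + k + M).toNat : ℕ) = i + k := by omega
        rw [h2] at h1
        simp only [iterate_shift]
        exact h1.symm
    exact hcov.coverMincard_le_card.trans (by exact_mod_cast Finset.card_image_le)
  rw [← ENNReal.log_ofReal_of_pos hlam, ← ExpGrowth.expGrowthSup_pow]
  refine ExpGrowth.expGrowthSup_le_of_eventually_le (b := ENNReal.ofReal (C * lam ^ (M + M)))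
    ENNReal.ofReal_ne_top (Filter.Eventually.of_forall fun m => ?_)
  calc _ ≤ (((words T S (M + m + M)).card : ℕ∞) : ENNReal) := ENat.toENNReal_mono (hcount m)
    _ = ENNReal.ofReal ((words T S (M + m + M)).card : ℝ) := by simp
    _ ≤ ENNReal.ofReal (C * lam ^ (M + M) * lam ^ m) := by
      refine ENNReal.ofReal_le_ofReal ((h _).trans_eq ?_)
      ring
    _ = _ := by rw [ENNReal.ofReal_mul' (by positivity), ENNReal.ofReal_pow hlam.le]

variable {v : Fin n → ℝ} {lam : ℝ}

/-- The entropy of the vertex shift is at most the logarithm of the Perron eigenvalue. -/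
theorem entropy_vertexShift_le [NeZero n] (hT : ∀ i j, T i j = 0 ∨ T i j = 1)
    (hv : ∀ i, 0 < v i) (hTv : T.mulVec v = lam • v) (hlam : 0 < lam) :
    entropy (vertexShift T) ≤ (Real.log lam : EReal) := by
  obtain ⟨c, a, C, hc0, ha, hC0, hc, hC, haw, hwC⟩ := exists_weight_bounds hv hlam
  have hv' : ∀ i, 0 ≤ v i := fun i => (hv i).le
  have hZ : ∀ m, weightSum T ∅ v c m ≤ weightSum T ∅ v c 0 * lam ^ m := by
    intro m
    induction m with
    | zero => simp
    | succ m ih =>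
      calc _ ≤ lam * weightSum T ∅ v c m := weightSum_empty_succ hT hTv hv' hc0.le hc m
        _ ≤ lam * (weightSum T ∅ v c 0 * lam ^ m) := mul_le_mul_of_nonneg_left ih hlam.le
        _ = _ := by ring
  rw [← avoiding_empty]
  refine entropy_le_log (C := weightSum T ∅ v c 0 / a) hlam fun m => ?_
  rw [div_mul_eq_mul_div, le_div_iff₀ ha]
  refine le_trans ?_ (hZ m)
  have := Finset.card_nsmul_le_sum (words T ∅ m) (weight v c) a fun u _ => haw u
  rwa [nsmul_eq_mul] at this

/-- If `S` consists of few long words, then forbidding them costs little entropy. -/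
theorem exists_log_le_entropy_avoiding [NeZero n] (hT : ∀ i j, T i j = 0 ∨ T i j = 1)
    (hv : ∀ i, 0 < v i) (hTv : T.mulVec v = lam • v) (hlam : 0 < lam) :
    ∃ C > 0, ∀ (S : Finset (List (Fin n))) (l : ℕ) (β : ℝ), 1 ≤ l → (∀ w ∈ S, l ≤ w.length) →
      1 ≤ β → C * S.card / β ^ (l - 1) ≤ lam - β →
      (Real.log β : EReal) ≤ entropy (avoiding T S) := by
  obtain ⟨c, a, C, hc0, ha, hC0, hc, hC, haw, hwC⟩ := exists_weight_bounds hv hlam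
  refine ⟨C, hC0, fun S l β hl0 hl hβ hβS => ?_⟩
  have hβ0 : 0 < β := one_pos.trans_le hβ
  have hstep := mul_weightSum_le hT hTv (fun i => (hv i).le) hc0.le hc hC0.le hC hl0 hl hβ hβS
  have hnil : [] ∈ words T S 0 := by
    refine mem_words.2 ⟨rfl, List.IsChain.nil, fun w hw hw' => ?_⟩
    have := hl w hw
    rw [List.infix_nil.1 hw'] at this
    exact absurd hl0 (by simpa using this)
  have hZ : ∀ m, c * β ^ m ≤ weightSum T S v c m := by
    intro m
    induction m with
    | zero =>
      rw [pow_zero, mul_one]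
      exact Finset.single_le_sum (f := weight v c)
        (fun u _ => weight_nonneg (fun i => (hv i).le) hc0.le u) hnil
    | succ m ih =>
      calc c * β ^ (m + 1) = β * (c * β ^ m) := by ring
        _ ≤ β * weightSum T S v c m := mul_le_mul_of_nonneg_left ih hβ0.le
        _ ≤ _ := hstep m
  refine log_le_entropy hβ0 (pow_le_card_language hβ (div_pos hc0 hC0) fun m => ?_)
  rw [div_mul_eq_mul_div, div_le_iff₀ hC0]
  refine (hZ m).trans ?_
  have := Finset.sum_le_card_nsmul (words T S m) (weight v c) C fun u _ => hwC u
  rwa [nsmul_eq_mul] at this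

end Entropy

/-! ### Asymptotics of the entropy loss -/

section Asymptotics

open Filter

variable {n : ℕ} {T : Matrix (Fin n) (Fin n) ℝ} {lam κ : ℝ} {S : ℕ → Finset (List (Fin n))}
  {l : ℕ → ℕ}

/-- Up to replacing `lam` by any smaller `b`, the entropy loss is at most of the order of the
expected number `(κ / lam) ^ l` of forbidden words at a given place. -/
lemma exists_entropy_avoiding_ge [NeZero n] (hT : ∀ i j, T i j = 0 ∨ T i j = 1)
    {v : Fin n → ℝ} (hv : ∀ i, 0 < v i) (hTv : T.mulVec v = lam • v)
    (hlen : ∀ i, ∀ w ∈ S i, l i ≤ w.length) (hl_top : Tendsto l atTop atTop) (hκ0 : 0 ≤ κ)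
    (hcard : (fun i => ((S i).card : ℝ)) =O[atTop] fun i => κ ^ l i)
    {b : ℝ} (hb1 : 1 < b) (hκb : κ < b) (hb : b < lam) :
    ∃ K > 0, ∀ᶠ i in atTop,
      ((Real.log lam - K * (κ / b) ^ l i : ℝ) : EReal) ≤ entropy (avoiding T (S i)) := by
  have hb0 : 0 < b := one_pos.trans hb1
  have hlam : 0 < lam := hb0.trans hb
  obtain ⟨C, hC0, hC⟩ := exists_log_le_entropy_avoiding hT hv hTv hlam
  obtain ⟨A, hA0, hA⟩ := hcard.exists_pos
  refine ⟨C * A, mul_pos hC0 hA0, ?_⟩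
  have hq : Tendsto (fun i => C * A * b * (κ / b) ^ l i) atTop (nhds 0) := by
    have h := (tendsto_pow_atTop_nhds_zero_of_lt_one (div_nonneg hκ0 hb0.le)
      ((div_lt_one hb0).2 hκb)).comp hl_top
    simpa using h.const_mul (C * A * b)
  filter_upwards [hA.bound, hl_top.eventually_ge_atTop 1,
    hq.eventually (gt_mem_nhds (sub_pos.2 hb))] with i hcardi hli hεi
  set ε := C * A * b * (κ / b) ^ l i with hε
  have hbβ : b ≤ lam - ε := by linarith
  have hβ0 : 0 < lam - ε := hb0.trans_le hbβ
  have hcardi' : ((S i).card : ℝ) ≤ A * κ ^ l i := by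
    simpa [abs_of_nonneg hκ0] using hcardi
  have hβ := hC (S i) (l i) (lam - ε) hli (hlen i) (hb1.le.trans hbβ) <| by
    calc C * (S i).card / (lam - ε) ^ (l i - 1) ≤ C * (A * κ ^ l i) / b ^ (l i - 1) := by
          gcongr
      _ = ε := by
        obtain ⟨k, hk⟩ := Nat.exists_eq_add_of_le' hli
        rw [hε, hk, Nat.add_sub_cancel, div_pow, pow_succ b]
        field_simp
      _ = lam - (lam - ε) := by ring
  refine le_trans (EReal.coe_le_coe_iff.2 ?_) hβ
  have h1 : Real.log (lam / (lam - ε)) ≤ lam / (lam - ε) - 1 :=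
    Real.log_le_sub_one_of_pos (div_pos hlam hβ0)
  rw [Real.log_div hlam.ne' hβ0.ne'] at h1
  have hε0 : 0 ≤ ε := by positivity
  have h2 : lam / (lam - ε) - 1 ≤ ε / b := by
    rw [div_sub_one hβ0.ne', sub_sub_cancel]
    exact div_le_div_of_nonneg_left hε0 hb0 hbβ
  have h3 : ε / b = C * A * (κ / b) ^ l i := by
    rw [hε]
    field_simp
  linarith

lemma pos_of_isBigO_pow (hl0 : ∀ i, (S i).Nonempty) (hl_top : Tendsto l atTop atTop)
    (hκ0 : 0 ≤ κ) (hcard : (fun i => ((S i).card : ℝ)) =O[atTop] fun i => κ ^ l i) : 0 < κ := by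
  refine lt_of_le_of_ne hκ0 fun h => ?_
  subst h
  obtain ⟨A, hA⟩ := hcard.bound
  obtain ⟨i, hi, hli⟩ := (hA.and (hl_top.eventually_ge_atTop 1)).exists
  have : (0 : ℝ) < (S i).card := by exact_mod_cast (hl0 i).card_pos
  rw [zero_pow (by omega)] at hi
  simp only [norm_zero, mul_zero] at hi
  exact absurd hi (not_le.2 (by simpa using hl0 i))

/-- The rate `κ / lam` is strictly better than `(κ / lam ^ (1 - 2 α)) ^ α`. -/
lemma div_lt_rpow {α : ℝ} (hlam1 : 1 < lam) (hκ0 : 0 < κ) (hκ : κ < lam) (hα0 : 0 < α)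
    (hα : α < 1) : κ / lam < (κ / lam ^ (1 - 2 * α)) ^ α := by
  have hlam : 0 < lam := one_pos.trans hlam1
  have hx0 : 0 < κ / lam := div_pos hκ0 hlam
  calc κ / lam = (κ / lam) ^ (1 : ℝ) := (Real.rpow_one _).symm
    _ < (κ / lam) ^ α := Real.rpow_lt_rpow_of_exponent_gt hx0 ((div_lt_one hlam).2 hκ) hα
    _ ≤ _ := by
      refine Real.rpow_le_rpow hx0.le ?_ hα0.le
      refine div_le_div_of_nonneg_left hκ0.le (by positivity) ?_
      calc lam ^ (1 - 2 * α) ≤ lam ^ (1 : ℝ) :=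
            Real.rpow_le_rpow_of_exponent_le hlam1.le (by linarith)
        _ = lam := Real.rpow_one _

/-- A smaller geometric rate absorbs the power `m ^ (α - 1)`. -/
lemma eventually_pow_le_mul_rpow {q r α : ℝ} (hq : 0 ≤ q) (hqr : q < r) (hα : 0 ≤ α) :
    ∀ᶠ m : ℕ in atTop, q ^ m ≤ r ^ m * (m : ℝ) ^ (α - 1) := by
  have hr : 0 < r := hq.trans_lt hqr
  have h := tendsto_self_mul_const_pow_of_lt_one (div_nonneg hq hr.le) ((div_lt_one hr).2 hqr)
  filter_upwards [h.eventually (gt_mem_nhds one_pos), eventually_ge_atTop 1] with m hm hm1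
  have hm0 : (1 : ℝ) ≤ m := by exact_mod_cast hm1
  rw [div_pow, ← mul_div_assoc, div_lt_one (by positivity)] at hm
  calc q ^ m ≤ r ^ m * (m : ℝ)⁻¹ := by
        rw [← div_eq_mul_inv, le_div_iff₀ (by positivity), mul_comm]
        exact hm.le
    _ = r ^ m * (m : ℝ) ^ (-1 : ℝ) := by rw [Real.rpow_neg_one]
    _ ≤ _ := by
      gcongr
      linarith

end Asymptotics

end ForbiddenWords

open ForbiddenWords Filter in
theorem theorem2 {n : ℕ} (T : Matrix (Fin n) (Fin n) ℝ)
    (hT01 : ∀ i j, T i j = 0 ∨ T i j = 1) (hTirr : T.IsIrreducible)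
    (lam : ℝ)
    (hlam : IsGreatest {x : ℝ | Module.End.HasEigenvalue (Matrix.toLin' T) x} lam)
    (hlam1 : 1 < lam)
    (S : ℕ → Finset (List (Fin n))) (hS : ∀ i, ForbiddenWords.IsForbiddenSet T (S i))
    (l : ℕ → ℕ) (hl : ∀ i, IsLeast {m : ℕ | ∃ w ∈ S i, w.length = m} (l i))
    (hl_top : Filter.Tendsto l Filter.atTop Filter.atTop)
    (κ : ℝ) (hκ0 : 0 ≤ κ) (hκ : κ < lam)
    (hcard : (fun i => ((S i).card : ℝ)) =O[Filter.atTop] fun i => κ ^ l i) :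
    Filter.Tendsto (fun i => ForbiddenWords.entropy (ForbiddenWords.avoiding T (S i)))
        Filter.atTop (nhds (ForbiddenWords.entropy (ForbiddenWords.vertexShift T))) ∧
    ∀ α : ℝ, 0 < α → α < 1 / 2 → κ < lam ^ (1 - 2 * α) →
      ∃ K : ℝ, ∀ᶠ i in Filter.atTop,
        ForbiddenWords.entropy (ForbiddenWords.avoiding T (S i)) ≤
            ForbiddenWords.entropy (ForbiddenWords.vertexShift T) ∧
        ForbiddenWords.entropy (ForbiddenWords.vertexShift T) ≤
            ForbiddenWords.entropy (ForbiddenWords.avoiding T (S i)) +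
              ((K * ((κ / lam ^ (1 - 2 * α)) ^ (α * (l i : ℝ)) * (l i : ℝ) ^ (α - 1)) : ℝ) :
                EReal) := by
  have hlam0 : 0 < lam := one_pos.trans hlam1
  obtain ⟨v, hv, hTv⟩ := exists_pos_eigenvector hTirr hlam hlam0.le
  have hn : NeZero n := by
    refine ⟨?_⟩
    rintro rfl
    obtain ⟨y, hy⟩ := hlam.1.exists_hasEigenvector
    exact hy.2 (Subsingleton.elim _ _)
  have hlen : ∀ i, ∀ w ∈ S i, l i ≤ w.length := fun i w hw => (hl i).2 ⟨w, hw, rfl⟩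
  have hne : ∀ i, (S i).Nonempty := fun i => (hl i).1.imp fun _ h => h.1
  have hκpos : 0 < κ := pos_of_isBigO_pow hne hl_top hκ0 hcard
  have hup : entropy (vertexShift T) ≤ (Real.log lam : EReal) :=
    entropy_vertexShift_le hT01 hv hTv hlam0
  have hmono : ∀ i, entropy (avoiding T (S i)) ≤ entropy (vertexShift T) :=
    fun i => entropy_mono fun _ hx => hx.1
  refine ⟨?_, fun α hα0 hα _ => ?_⟩
  · obtain ⟨b, hb, hblam⟩ := exists_between (max_lt hlam1 hκ)
    have hb1 : 1 < b := (le_max_left _ _).trans_lt hb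
    have hκb : κ < b := (le_max_right _ _).trans_lt hb
    obtain ⟨K, -, hK⟩ :=
      exists_entropy_avoiding_ge hT01 hv hTv hlen hl_top hκ0 hcard hb1 hκb hblam
    have hlim : Tendsto (fun i => ((Real.log lam - K * (κ / b) ^ l i : ℝ) : EReal)) atTop
        (nhds (Real.log lam : EReal)) := by
      have h := (tendsto_pow_atTop_nhds_zero_of_lt_one (div_nonneg hκ0 (one_pos.trans hb1).le)
        ((div_lt_one (one_pos.trans hb1)).2 hκb)).comp hl_top
      have h' := (h.const_mul K).const_sub (Real.log lam)
      rw [mul_zero, sub_zero] at h'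
      exact (continuous_coe_real_ereal.tendsto _).comp h'
    have heq : entropy (vertexShift T) = (Real.log lam : EReal) :=
      le_antisymm hup (le_of_tendsto hlim (hK.mono fun i hi => hi.trans (hmono i)))
    rw [heq] at hmono ⊢
    exact tendsto_of_tendsto_of_tendsto_of_le_of_le' hlim tendsto_const_nhds hK
      (Eventually.of_forall hmono)
  · set r := (κ / lam ^ (1 - 2 * α)) ^ α with hr
    have hbase : 0 < κ / lam ^ (1 - 2 * α) := by positivity
    have hr0 : 0 < r := Real.rpow_pos_of_pos hbase α
    have hrlam : κ / r < lam := by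
      have := div_lt_rpow hlam1 hκpos hκ hα0 (by linarith)
      rw [div_lt_iff₀ hlam0] at this
      rwa [div_lt_iff₀ hr0, mul_comm]
    obtain ⟨b, hb, hblam⟩ := exists_between (max_lt (max_lt hlam1 hκ) hrlam)
    have hb1 : 1 < b := (max_lt_iff.1 (max_lt_iff.1 hb).1).1
    have hκb : κ < b := (max_lt_iff.1 (max_lt_iff.1 hb).1).2
    have hb0 : 0 < b := one_pos.trans hb1
    have hqr : κ / b < r := by
      rw [div_lt_iff₀ hb0, mul_comm]
      exact (div_lt_iff₀ hr0).1 (max_lt_iff.1 hb).2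
    obtain ⟨K, hK0, hK⟩ :=
      exists_entropy_avoiding_ge hT01 hv hTv hlen hl_top hκ0 hcard hb1 hκb hblam
    refine ⟨K, ?_⟩
    filter_upwards [hK, hl_top.eventually
      (eventually_pow_le_mul_rpow (div_nonneg hκ0 hb0.le) hqr hα0.le)] with i hi hli
    refine ⟨hmono i, ?_⟩
    rw [Real.rpow_mul hbase.le, Real.rpow_natCast, ← hr]
    calc entropy (vertexShift T) ≤ (Real.log lam : EReal) := hup
      _ = ((Real.log lam - K * (κ / b) ^ l i : ℝ) : EReal) + ((K * (κ / b) ^ l i : ℝ) : EReal) := by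
        rw [← EReal.coe_add, sub_add_cancel]
      _ ≤ _ := add_le_add hi (EReal.coe_le_coe_iff.2 (mul_le_mul_of_nonneg_left hli hK0.le))
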